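/- Conventions: $\log$ is the logarithm to base $2$. For a nonzero $f\in\mathbb{C}[Y]$ let $V_{\mathbb{C}}(f)$ be the set of its distinct complex roots, $\operatorname{mult}(w,f)$ the multiplicity of $w$ as a root of $f$, and $f^{[k]}=f^{(k)}/k!$. For $w\in V_{\mathbb{C}}(f)$ let $\operatorname{sep}(w,f)=\min\{|y-w| : y\in V_{\mathbb{C}}(f),\ y\neq w\}$, with the convention $\operatorname{sep}(w,f)=1$ if $w$ is the only root of $f$. Put $$\widehat{\operatorname{logGDisc}}(f)=\max\Bigl(1,\sum_{w\in V_{\mathbb{C}}(f)}\operatorname{mult}(w,f)\,\bigl|\log|f^{[\operatorname{mult}(w,f)]}(w)|\bigr|\Bigr),\qquad \operatorname{logsep}(f)=\max\Bigl(1,\sum_{w\in V_{\mathbb{C}}(f)}\operatorname{mult}(w,f)\,\bigl|\log\operatorname{sep}(w,f)\bigr|\Bigr).$$ A polynomial with integer coefficients in one or two variables is of magnitude $(d,\sigma)$, where $d,\sigma\in\mathbb{Z}_{\ge 0}$, if its (total) degree is at most $d$ and all its coefficients have absolute value at most $2^\sigma$. **Proposition.** Let $R\in\mathbb{Z}[X]$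 be nonzero and of magnitude $(N,\Lambda)$, let $F\in\mathbb{Z}[X,Y]$ be of magnitude $(n,\tau)$ with $n\ge 1$, and suppose that $$V_{\mathbb{C}}(R,F)=\{(z,z')\in\mathbb{C}^2 : R(z)=F(z,z')=0\}$$ is finite. Write $\mu(z)=\operatorname{mult}(z,R)$. Then (a) $\displaystyle\sum_{z\in V_{\mathbb{C}}(R)}\mu(z)\cdot\widehat{\operatorname{logGDisc}}(F(z,-))\in\tilde{O}\bigl(n(N\tau+n\Lambda+Nn)\bigr)$; (b) $\displaystyle\sum_{z\in V_{\mathbb{C}}(R)}\mu(z)\cdot\operatorname{logsep}(F(z,-))\in\tilde{O}\bigl(n(N\tau+n\Lambda+Nn)\bigr)$. Here a quantity is in $\tilde{O}(M)$ if it is at most $C\,M\,(\log(2+M))^k$, where $C$ and $k$ are absolute constants, independent of $N,\Lambda,n,\tau,R,F$. -/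

import Mathlib

open Polynomial

namespace AmortizedBounds

noncomputable section

/-- `V_ℂ(f)`: the set of distinct complex roots of a (nonzero) polynomial `f ∈ ℂ[X]`. -/
def rootsC (f : ℂ[X]) : Finset ℂ := f.roots.toFinset

/-- The separation of `f` at `z`: the minimal distance from `z` to another root of `f`.
If `f` has no root other than `z`, the minimum is over the empty set, and we put `sep z f = 1`,
so that `log (sep z f) = 0`. -/
def sep (z : ℂ) (f : ℂ[X]) : ℝ :=
  if h : ((rootsC f).erase z).Nonempty then ((rootsC f).erase z).inf' h (fun y => ‖y - z‖) else 1

/-- `logsep f = max(1, ∑_{z ∈ V_ℂ(f)} mult(z, f) * |log sep(z, f)|)`. -/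
def logsep (f : ℂ[X]) : ℝ :=
  max 1 (∑ z ∈ rootsC f, (f.rootMultiplicity z : ℝ) * |Real.logb 2 (sep z f)|)

/-- `max(1, ∑_{z ∈ V_ℂ(f)} mult(z, f) * |log |f^{[mult(z, f)]}(z)||)`, where `f^{[k]} = f^{(k)} / k!`
is the `k`-th Hasse derivative of `f`. -/
def logGDisc (f : ℂ[X]) : ℝ :=
  max 1 (∑ z ∈ rootsC f, (f.rootMultiplicity z : ℝ) *
    |Real.logb 2 ‖(hasseDeriv (f.rootMultiplicity z) f).eval z‖|)

/-- `R ∈ ℤ[X]` is of magnitude `(N, Λ)`: its degree is at most `N`, and all its coefficients have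
absolute value at most `2 ^ Λ`. -/
def HasMagnitude (R : ℤ[X]) (N Λ : ℕ) : Prop :=
  R.natDegree ≤ N ∧ ∀ i, |R.coeff i| ≤ 2 ^ Λ

/-- `F ∈ ℤ[X, Y]`, written as a polynomial in `Y` over `ℤ[X]`, is of magnitude `(n, τ)`: its total
degree is at most `n`, and all its coefficients have absolute value at most `2 ^ τ`. Here
`(F.coeff j).coeff i` is the coefficient of `X ^ i * Y ^ j`. -/
def HasMagnitude₂ (F : ℤ[X][X]) (n τ : ℕ) : Prop :=
  (∀ i j, (F.coeff j).coeff i ≠ 0 → i + j ≤ n) ∧ ∀ i j, |(F.coeff j).coeff i| ≤ 2 ^ τ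

/-- `R ∈ ℤ[X]` viewed as a complex polynomial. -/
def toC (R : ℤ[X]) : ℂ[X] := R.map (Int.castRingHom ℂ)

/-- The polynomial `F(z, -) ∈ ℂ[Y]`. -/
def fiber (F : ℤ[X][X]) (z : ℂ) : ℂ[X] := F.map (eval₂RingHom (Int.castRingHom ℂ) z)

/-- `V_ℂ(R, F) = {(z, z') ∈ ℂ² | R(z) = F(z, z') = 0}`. -/
def zeroSet (R : ℤ[X]) (F : ℤ[X][X]) : Set (ℂ × ℂ) :=
  {p | (toC R).eval p.1 = 0 ∧ (fiber F p.1).eval p.2 = 0}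

end

end AmortizedBounds

namespace AmortizedBounds

/-! Upper bounds for log|F(z,w)|-type quantities come from Mahler measures; the difficulty is a
lower bound valid for all roots together, including fibers with multiple roots or a degree drop. The
device is an auxiliary variable U. If T ∈ ℤ[U][X] does not vanish identically at any root z of R,
then Res_X(R, T) is a nonzero element of ℤ[U], so its trailing coefficient is a nonzero integer.
Trailing coefficients are multiplicative, hence the product of those of T(z), scaled by a power of
lc(R), has absolute value at least 1 (`one_le_leadingCoeff_pow_mul_prod_trailingCoeff`).

Two choices of T are used. For `leadForm` the trailing coefficient at z is the leading coefficient
of F(z,-). For `discForm` it is, up to sign, lc(F(z,-))^n times the product over the roots w, with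
multiplicity, of F(z,-)^{[mult(w)]}(w) (`norm_trailingCoeff_specialize_discForm`).

In one fiber, `rootBound` dominates both sums of absolute values by upper bounds minus the signed
sum of `logTrail`. Summing over z, Mahler measure controls the positive part and the two integrality
bounds control the negative part. -/

theorem norm_multiset_prod (s : Multiset ℂ) : ‖s.prod‖ = (s.map norm).prod :=
  map_multiset_prod (normHom : ℂ →*₀ ℝ) s

/-! ### Trailing coefficients. -/

section Trailing

/-- The trailing coefficient, as a monoid homomorphism. -/
noncomputable def trailingCoeffHom (A : Type*) [CommRing A] [IsDomain A] : A[X] →* A where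
  toFun := trailingCoeff
  map_one' := by simp [trailingCoeff]
  map_mul' := trailingCoeff_mul

theorem trailingCoeff_multiset_prod {A : Type*} [CommRing A] [IsDomain A] (s : Multiset A[X]) :
    s.prod.trailingCoeff = (s.map trailingCoeff).prod :=
  map_multiset_prod (trailingCoeffHom A) s

theorem trailingCoeff_pow' {A : Type*} [CommRing A] [IsDomain A] (p : A[X]) (n : ℕ) :
    (p ^ n).trailingCoeff = p.trailingCoeff ^ n :=
  map_pow (trailingCoeffHom A) p n

theorem trailingCoeff_C' {A : Type*} [CommRing A] (a : A) : (C a).trailingCoeff = a := by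
  simp [trailingCoeff]

theorem trailingCoeff_X_pow {A : Type*} [CommRing A] [IsDomain A] (n : ℕ) :
    ((X : A[X]) ^ n).trailingCoeff = 1 := by
  rw [trailingCoeff_pow']
  simp [trailingCoeff]

theorem trailingCoeff_eq_of_coeff {A : Type*} [CommRing A] {p : A[X]} {m : ℕ}
    (h : p.coeff m ≠ 0) (hlt : ∀ i < m, p.coeff i = 0) : p.trailingCoeff = p.coeff m := by
  have hp : p ≠ 0 := by rintro rfl; simp at h
  rw [trailingCoeff, le_antisymm (natTrailingDegree_le_of_ne_zero h) (le_natTrailingDegree hp hlt)]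

theorem trailingCoeff_map_of_injective {A B : Type*} [CommRing A] [CommRing B] {φ : A →+* B}
    (hφ : Function.Injective φ) (p : A[X]) : (p.map φ).trailingCoeff = φ p.trailingCoeff := by
  rcases eq_or_ne p 0 with rfl | hp
  · simp
  have h0 : p.trailingCoeff ≠ 0 := trailingCoeff_nonzero_iff_nonzero.2 hp
  rw [trailingCoeff_eq_of_coeff (m := p.natTrailingDegree), coeff_map, trailingCoeff]
  · rw [coeff_map]
    exact (map_ne_zero_iff φ hφ).2 h0
  · intro i hi
    rw [coeff_map, coeff_eq_zero_of_lt_natTrailingDegree hi, map_zero]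

/-- The perturbation only touches degrees above that of `p`; this makes the U^(n+1) term in `shiftU`
harmless. -/
theorem trailingCoeff_add_X_pow_mul {A : Type*} [CommRing A] {p : A[X]} (hp : p ≠ 0) {k : ℕ}
    (hk : p.natDegree < k) (q : A[X]) : (p + X ^ k * q).trailingCoeff = p.trailingCoeff := by
  have hlt : ∀ i ≤ p.natTrailingDegree, (p + X ^ k * q).coeff i = p.coeff i := by
    intro i hi
    have : ¬ k ≤ i := by
      have := natTrailingDegree_le_natDegree p
      omega
    simp [coeff_X_pow_mul', this]
  have h0 : p.trailingCoeff ≠ 0 := trailingCoeff_nonzero_iff_nonzero.2 hp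
  rw [trailingCoeff_eq_of_coeff (m := p.natTrailingDegree), hlt _ le_rfl, trailingCoeff]
  · rwa [hlt _ le_rfl]
  · intro i hi
    rw [hlt i hi.le, coeff_eq_zero_of_lt_natTrailingDegree hi]

end Trailing

/-! ### Integrality of products over the roots of R. -/

section Specialization

/-- Specialization `X ↦ z` of polynomials in `X` over `ℤ[U]`. -/
noncomputable def specialize (z : ℂ) : ℤ[X][X] →+* ℂ[X] :=
  eval₂RingHom (mapRingHom (Int.castRingHom ℂ)) (C z)

theorem specialize_C (z : ℂ) (p : ℤ[X]) :
    specialize z (C p) = p.map (Int.castRingHom ℂ) := by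
  simp [specialize]

theorem specialize_map_C (z : ℂ) (c : ℤ[X]) :
    specialize z (c.map C) = C (eval₂ (Int.castRingHom ℂ) z c) := by
  have : (specialize z).comp (mapRingHom C) =
      C.comp (eval₂RingHom (Int.castRingHom ℂ) z) := by
    ext <;> simp [specialize]
  exact congr($this c)

/-- If `T ∈ ℤ[U][X]` vanishes at no root of `R ∈ ℤ[X]`, the product over the roots `z` of `R` of the
trailing coefficients of `T(z)`, scaled by a power of the leading coefficient of `R`, is a nonzero
integer. -/
theorem one_le_leadingCoeff_pow_mul_prod_trailingCoeff {R : ℤ[X]} (hR : R ≠ 0) {T : ℤ[X][X]} {D : ℕ}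
    (hD : T.natDegree ≤ D) (hT : ∀ z ∈ (toC R).roots, specialize z T ≠ 0) :
    1 ≤ ‖(R.leadingCoeff : ℂ)‖ ^ D *
      ((toC R).roots.map fun z => ‖(specialize z T).trailingCoeff‖).prod := by
  have hinj : Function.Injective (Int.castRingHom ℂ) := Int.cast_injective
  set φ : ℤ[X] →+* ℂ[X] := mapRingHom (Int.castRingHom ℂ) with hφ
  set r : ℤ[X] := resultant (R.map C) T R.natDegree D with hr
  have hmap : (R.map C).map φ = (toC R).map C := by
    rw [toC, Polynomial.map_map, Polynomial.map_map]
    congr 1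
    ext
    simp
  have hdeg : ((toC R).map (C : ℂ →+* ℂ[X])).natDegree = R.natDegree := by
    rw [natDegree_map_eq_of_injective (C_injective), toC, natDegree_map_eq_of_injective hinj]
  have hlc : ((toC R).map (C : ℂ →+* ℂ[X])).leadingCoeff = C (R.leadingCoeff : ℂ) := by
    rw [leadingCoeff_map_of_injective C_injective, toC, leadingCoeff_map_of_injective hinj]
    simp
  have hsp : (toC R).Splits := IsAlgClosed.splits _
  have hres : r.map (Int.castRingHom ℂ) = C (R.leadingCoeff : ℂ) ^ D *
      ((toC R).roots.map fun z => specialize z T).prod := by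
    have h1 : φ r = resultant ((R.map C).map φ) (T.map φ) R.natDegree D := by
      rw [resultant_map_map]
    have h2 : ((toC R).map (C : ℂ →+* ℂ[X])).Splits := hsp.map _
    rw [← coe_mapRingHom, ← hφ, h1, hmap, ← hdeg,
      resultant_eq_prod_eval _ _ _ (natDegree_map_le.trans hD) h2, hlc, hsp.roots_map C,
      Multiset.map_map]
    congr 3
    ext1 z
    simp [specialize, eval_map, hφ]
  have hlc0 : (R.leadingCoeff : ℂ) ≠ 0 := by simpa using hR
  have hr0 : r ≠ 0 := by
    intro h0
    rw [h0, Polynomial.map_zero, eq_comm, mul_eq_zero, Multiset.prod_eq_zero_iff] at hres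
    rcases hres with h | h
    · exact hlc0 (C_eq_zero.1 (eq_zero_of_pow_eq_zero h))
    · obtain ⟨z, hz, h⟩ := Multiset.mem_map.1 h
      exact hT z hz h
  -- On one side stands a nonzero integer, on the other the product of trailing coefficients.
  have htr := congrArg (fun p => ‖trailingCoeff p‖) hres
  simp only [trailingCoeff_map_of_injective hinj, trailingCoeff_mul, trailingCoeff_pow',
    trailingCoeff_C', trailingCoeff_multiset_prod, Multiset.map_map, norm_mul, norm_pow] at htr
  rw [norm_multiset_prod, Multiset.map_map] at htr
  refine le_of_le_of_eq ?_ htr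
  have : r.trailingCoeff ≠ 0 := trailingCoeff_nonzero_iff_nonzero.2 hr0
  rw [eq_intCast, Complex.norm_intCast]
  exact_mod_cast Int.one_le_abs this

theorem zero_le_log_leadingCoeff_add_sum_log_trailingCoeff {R : ℤ[X]} (hR : R ≠ 0) {T : ℤ[X][X]}
    {D : ℕ} (hD : T.natDegree ≤ D) (hT : ∀ z ∈ (toC R).roots, specialize z T ≠ 0) :
    0 ≤ D * Real.log ‖(R.leadingCoeff : ℂ)‖ +
      ((toC R).roots.map fun z => Real.log ‖(specialize z T).trailingCoeff‖).sum := by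
  have h := Real.log_nonneg (one_le_leadingCoeff_pow_mul_prod_trailingCoeff hR hD hT)
  have h0 : ∀ x ∈ (toC R).roots.map fun z => ‖(specialize z T).trailingCoeff‖, x ≠ 0 := by
    intro x hx
    obtain ⟨z, hz, rfl⟩ := Multiset.mem_map.1 hx
    exact norm_ne_zero_iff.2 (trailingCoeff_nonzero_iff_nonzero.2 (hT z hz))
  rwa [Real.log_mul (by simpa using fun h => absurd h hR) (Multiset.prod_ne_zero fun h => h0 0 h rfl),
    Real.log_pow, Real.log_multiset_prod h0, Multiset.map_map] at h

end Specialization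

/-! ### Leading coefficients of the fibers. -/

section Fiber

theorem coeff_fiber (F : ℤ[X][X]) (z : ℂ) (j : ℕ) :
    (fiber F z).coeff j = eval₂ (Int.castRingHom ℂ) z (F.coeff j) := by
  simp [fiber]

theorem HasMagnitude₂.natDegree_coeff_le {F : ℤ[X][X]} {n τ : ℕ} (hF : HasMagnitude₂ F n τ) (j : ℕ) :
    (F.coeff j).natDegree ≤ n :=
  natDegree_le_iff_coeff_eq_zero.2 fun i hi => by
    by_contra h
    have := hF.1 i j h
    omega

theorem HasMagnitude₂.natDegree_le {F : ℤ[X][X]} {n τ : ℕ} (hF : HasMagnitude₂ F n τ) :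
    F.natDegree ≤ n :=
  natDegree_le_iff_coeff_eq_zero.2 fun j hj => by
    ext i
    by_contra h
    have := hF.1 i j h
    omega

theorem HasMagnitude₂.natDegree_fiber_le {F : ℤ[X][X]} {n τ : ℕ} (hF : HasMagnitude₂ F n τ) (z : ℂ) :
    (fiber F z).natDegree ≤ n :=
  natDegree_map_le.trans hF.natDegree_le

/-- `∑ⱼ U ^ (n - j) cⱼ(X)` for `F = ∑ⱼ cⱼ(X) Y ^ j`. -/
noncomputable def leadForm (F : ℤ[X][X]) (n : ℕ) : ℤ[X][X] :=
  ∑ j ∈ Finset.range (n + 1), C (X ^ (n - j)) * (F.coeff j).map C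

theorem natDegree_leadForm_le {F : ℤ[X][X]} {n τ : ℕ} (hF : HasMagnitude₂ F n τ) :
    (leadForm F n).natDegree ≤ n :=
  natDegree_sum_le_of_forall_le _ _ fun j _ =>
    (natDegree_C_mul_le _ _).trans (natDegree_map_le.trans (hF.natDegree_coeff_le j))

theorem specialize_leadForm (F : ℤ[X][X]) (n : ℕ) (z : ℂ) : specialize z (leadForm F n) =
    ∑ j ∈ Finset.range (n + 1), C ((fiber F z).coeff j) * X ^ (n - j) := by
  simp [leadForm, specialize_C, specialize_map_C, coeff_fiber, mul_comm]

theorem coeff_specialize_leadForm (F : ℤ[X][X]) (n : ℕ) (z : ℂ) {i : ℕ} (hi : i ≤ n) :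
    (specialize z (leadForm F n)).coeff i = (fiber F z).coeff (n - i) := by
  rw [specialize_leadForm, finsetSum_coeff, Finset.sum_eq_single (n - i)]
  · simp [Nat.sub_sub_self hi]
  · intro j hj hne
    have : i ≠ n - j := by have := Finset.mem_range.1 hj; omega
    simp [coeff_X_pow, this]
  · intro h
    exact absurd (Finset.mem_range.2 (by omega)) h

theorem coeff_specialize_leadForm_natDegree {F : ℤ[X][X]} {n τ : ℕ} (hF : HasMagnitude₂ F n τ) (z : ℂ) :
    (specialize z (leadForm F n)).coeff (n - (fiber F z).natDegree) =
      (fiber F z).leadingCoeff := by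
  rw [coeff_specialize_leadForm _ _ _ (Nat.sub_le _ _),
    Nat.sub_sub_self (hF.natDegree_fiber_le z), leadingCoeff]

theorem specialize_leadForm_ne_zero {F : ℤ[X][X]} {n τ : ℕ} (hF : HasMagnitude₂ F n τ) {z : ℂ}
    (hz : fiber F z ≠ 0) : specialize z (leadForm F n) ≠ 0 := fun h => by
  have := coeff_specialize_leadForm_natDegree hF z
  rw [h, coeff_zero, eq_comm, leadingCoeff_eq_zero] at this
  exact hz this

/-- The weights U^(n-j) reverse the order of the coefficients, so the lowest surviving power of U
picks out the top nonzero coefficient even where the degree in Y drops. -/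
theorem trailingCoeff_specialize_leadForm {F : ℤ[X][X]} {n τ : ℕ} (hF : HasMagnitude₂ F n τ) {z : ℂ}
    (hz : fiber F z ≠ 0) :
    (specialize z (leadForm F n)).trailingCoeff = (fiber F z).leadingCoeff := by
  have h := coeff_specialize_leadForm_natDegree hF z
  rw [trailingCoeff_eq_of_coeff (m := n - (fiber F z).natDegree), h]
  · rw [h]
    exact leadingCoeff_ne_zero.2 hz
  · intro i hi
    rw [coeff_specialize_leadForm _ _ _ (by omega), coeff_eq_zero_of_natDegree_lt (by omega)]

end Fiber

/-! ### The generalized discriminant as a trailing coefficient. -/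

section GeneralizedDiscriminant

theorem natDegree_det_le_of_entry {A : Type*} [CommRing A] {m d : ℕ} (M : Matrix (Fin m) (Fin m) A[X])
    (hM : ∀ i j, (M i j).natDegree ≤ d) : M.det.natDegree ≤ m * d := by
  rw [Matrix.det_apply]
  refine natDegree_sum_le_of_forall_le _ _ fun σ _ => ?_
  refine (natDegree_smul_le _ _).trans ((natDegree_prod_le _ _).trans ?_)
  refine (Finset.sum_le_card_nsmul _ _ d fun i _ => hM _ _).trans ?_
  simp

theorem natDegree_resultant_le {A : Type*} [CommRing A] {f g : A[X][X]} {m n d : ℕ}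
    (hf : ∀ i, (f.coeff i).natDegree ≤ d) (hg : ∀ i, (g.coeff i).natDegree ≤ d) :
    (resultant f g m n).natDegree ≤ (m + n) * d := by
  refine natDegree_det_le_of_entry _ fun i j => ?_
  induction j using Fin.addCases with
  | left j =>
    simp only [sylvester, Matrix.of_apply, Fin.addCases_left]
    split_ifs
    · exact hg _
    · simp
  | right j =>
    simp only [sylvester, Matrix.of_apply, Fin.addCases_right]
    split_ifs
    · exact hf _
    · simp

/-- `F(X, Y)` with coefficients viewed in `ℤ[U][X]`. -/
noncomputable def liftU (F : ℤ[X][X]) : ℤ[X][X][X] := F.map (mapRingHom C)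

/-- `F(X, Y + U) + U ^ (n + 1) Y ^ n`. -/
noncomputable def shiftU (F : ℤ[X][X]) (n : ℕ) : ℤ[X][X][X] :=
  taylor (C X) (liftU F) + C (C X ^ (n + 1)) * X ^ n

/-- The resultant with respect to `Y` of `F(X, Y)` and `F(X, Y + U) + U ^ (n + 1) Y ^ n`. -/
noncomputable def discForm (F : ℤ[X][X]) (n : ℕ) : ℤ[X][X] :=
  resultant (liftU F) (shiftU F n) n n

theorem natDegree_coeff_liftU_le {F : ℤ[X][X]} {n τ : ℕ} (hF : HasMagnitude₂ F n τ) (i : ℕ) :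
    ((liftU F).coeff i).natDegree ≤ n := by
  rw [liftU, coeff_map]
  exact natDegree_map_le.trans (hF.natDegree_coeff_le i)

theorem natDegree_coeff_shiftU_le {F : ℤ[X][X]} {n τ : ℕ} (hF : HasMagnitude₂ F n τ) (i : ℕ) :
    ((shiftU F n).coeff i).natDegree ≤ n := by
  rw [shiftU, coeff_add]
  refine (natDegree_add_le _ _).trans (max_le ?_ ?_)
  · rw [taylor_coeff, eval_eq_sum_range]
    refine natDegree_sum_le_of_forall_le _ _ fun k _ => ?_
    rw [hasseDeriv_coeff, ← C_pow]
    refine (natDegree_mul_C_le _ _).trans ?_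
    rw [← nsmul_eq_mul]
    exact (natDegree_smul_le _ _).trans (natDegree_coeff_liftU_le hF _)
  · rw [coeff_C_mul, coeff_X_pow, ← C_pow]
    split_ifs <;> simp

theorem natDegree_discForm_le {F : ℤ[X][X]} {n τ : ℕ} (hF : HasMagnitude₂ F n τ) :
    (discForm F n).natDegree ≤ (n + n) * n :=
  natDegree_resultant_le (natDegree_coeff_liftU_le hF) (natDegree_coeff_shiftU_le hF)

theorem map_specialize_liftU (F : ℤ[X][X]) (z : ℂ) :
    (liftU F).map (specialize z) = (fiber F z).map C := by
  rw [liftU, fiber, Polynomial.map_map, Polynomial.map_map]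
  congr 1
  ext <;> simp [specialize]

theorem map_specialize_shiftU (F : ℤ[X][X]) (n : ℕ) (z : ℂ) :
    (shiftU F n).map (specialize z) =
      taylor X ((fiber F z).map C) + C (X ^ (n + 1)) * X ^ n := by
  rw [shiftU, Polynomial.map_add, map_taylor, map_specialize_liftU]
  simp [specialize_C]

theorem coeff_taylor_of_natDegree_le {A : Type*} [CommRing A] {f : A[X]} {n : ℕ}
    (hn : f.natDegree ≤ n) (r : A) : (taylor r f).coeff n = f.coeff n := by
  rcases hn.eq_or_lt with rfl | h
  · rw [coeff_taylor_natDegree, leadingCoeff]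
  · rw [coeff_eq_zero_of_natDegree_lt h, coeff_eq_zero_of_natDegree_lt (by rwa [natDegree_taylor])]

theorem eval_C_map_specialize_shiftU (F : ℤ[X][X]) (n : ℕ) (z w : ℂ) :
    ((shiftU F n).map (specialize z)).eval (C w) =
      taylor w (fiber F z) + X ^ (n + 1) * C (w ^ n) := by
  rw [map_specialize_shiftU, eval_add, taylor_eval, eval_map, taylor_apply, comp, add_comm (C w)]
  simp

/-- By the product formula the resultant is a product of f(w+U) + U^(n+1) w^n over the roots w of f
= F(z,-), whose lowest terms in U are those of f(w+U). The U^(n+1) Y^n term keeps the formal top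
coefficient nonzero when deg f < n, so the resultant does not vanish there. -/
theorem norm_trailingCoeff_specialize_discForm {F : ℤ[X][X]} {n τ : ℕ} (hF : HasMagnitude₂ F n τ)
    {z : ℂ} (hz : fiber F z ≠ 0) :
    ‖(specialize z (discForm F n)).trailingCoeff‖ = ‖(fiber F z).leadingCoeff‖ ^ n *
      ((fiber F z).roots.map fun w => ‖(taylor w (fiber F z)).trailingCoeff‖).prod := by
  set f := fiber F z with hf
  have hd : f.natDegree ≤ n := hF.natDegree_fiber_le z
  set g := (shiftU F n).map (specialize z) with hg
  have hgd : g.natDegree ≤ n := by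
    rw [hg, map_specialize_shiftU]
    refine (natDegree_add_le _ _).trans (max_le ?_ (natDegree_C_mul_X_pow_le _ _))
    rw [natDegree_taylor]
    exact natDegree_map_le.trans hd
  have hgn : g.coeff n = C (f.coeff n) + X ^ (n + 1) := by
    rw [hg, map_specialize_shiftU, coeff_add, coeff_taylor_of_natDegree_le
      (natDegree_map_le.trans hd), coeff_map, coeff_C_mul, coeff_X_pow, if_pos rfl, mul_one]
  have hsp : f.Splits := IsAlgClosed.splits _
  have hres : specialize z (discForm F n) = (-1) ^ (n * (n - f.natDegree)) *
      g.coeff n ^ (n - f.natDegree) *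
        (C f.leadingCoeff ^ n * (f.roots.map fun w => g.eval (C w)).prod) := by
    have hfd : (f.map (C : ℂ →+* ℂ[X])).natDegree = f.natDegree :=
      natDegree_map_eq_of_injective C_injective f
    have h1 : resultant (f.map C) g f.natDegree n =
        C f.leadingCoeff ^ n * (f.roots.map fun w => g.eval (C w)).prod := by
      rw [← hfd, resultant_eq_prod_eval _ _ _ hgd (hsp.map _),
        leadingCoeff_map_of_injective C_injective, hsp.roots_map C, Multiset.map_map]
      rfl
    -- Raising the formal degree of f from deg f to n costs a sign and the factor `g.coeff n ^ (n -
    -- f.natDegree)`.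
    rw [← h1, ← resultant_add_left_deg _ _ _ _ _ hfd.le, Nat.add_sub_cancel' hd, discForm,
      ← resultant_map_map, map_specialize_liftU]
  -- If deg f < n, then `g.coeff n` is exactly U^(n+1), with trailing coefficient 1; otherwise the
  -- exponent is 0.
  have hc : ‖(g.coeff n ^ (n - f.natDegree)).trailingCoeff‖ = 1 := by
    rcases hd.eq_or_lt with h | h
    · simp [h, trailingCoeff]
    · rw [hgn, coeff_eq_zero_of_natDegree_lt h, C_0, zero_add, trailingCoeff_pow',
        trailingCoeff_X_pow, one_pow, norm_one]
  have hs : ‖(((-1 : ℂ[X]) ^ (n * (n - f.natDegree)))).trailingCoeff‖ = 1 := by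
    rw [trailingCoeff_pow', ← C_1, ← C_neg, trailingCoeff_C']
    simp
  rw [hres, trailingCoeff_mul, trailingCoeff_mul, trailingCoeff_mul, norm_mul, norm_mul, hs, hc,
    one_mul, one_mul, norm_mul, trailingCoeff_pow', trailingCoeff_C', norm_pow,
    trailingCoeff_multiset_prod, Multiset.map_map]
  rw [norm_multiset_prod, Multiset.map_map]
  congr 2
  refine Multiset.map_congr rfl fun w _ => ?_
  simp only [Function.comp, hg, eval_C_map_specialize_shiftU]
  rw [trailingCoeff_add_X_pow_mul ((taylor_eq_zero w f).not.2 hz)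
    (by rw [natDegree_taylor]; omega)]

theorem specialize_discForm_ne_zero {F : ℤ[X][X]} {n τ : ℕ} (hF : HasMagnitude₂ F n τ) {z : ℂ}
    (hz : fiber F z ≠ 0) : specialize z (discForm F n) ≠ 0 := fun h => by
  have := norm_trailingCoeff_specialize_discForm hF hz
  rw [h, trailingCoeff_zero, norm_zero, eq_comm, mul_eq_zero, Multiset.prod_eq_zero_iff] at this
  rcases this with h | h
  · exact hz (by simpa using eq_zero_of_pow_eq_zero h)
  · obtain ⟨w, -, h⟩ := Multiset.mem_map.1 h
    simp [hz] at h

end GeneralizedDiscriminant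

/-! ### Separation and Hasse derivatives within one fiber. -/

section Roots

theorem sum_rootsC_rootMultiplicity_mul (f : ℂ[X]) (φ : ℂ → ℝ) :
    ∑ z ∈ rootsC f, (f.rootMultiplicity z : ℝ) * φ z = (f.roots.map φ).sum := by
  classical
  rw [Finset.sum_multiset_map_count]
  unfold rootsC
  convert rfl using 2 with z hz
  simp

theorem trailingCoeff_taylor {f : ℂ[X]} (w : ℂ) :
    (taylor w f).trailingCoeff = (hasseDeriv (f.rootMultiplicity w) f).eval w := by
  rw [rootMultiplicity_eq_natTrailingDegree, ← taylor_coeff, ← taylor_apply, trailingCoeff]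

/-- Each linear factor of f(w+U) is U + (w - y), whose trailing coefficient is w - y, or 1 when y =
w. -/
theorem trailingCoeff_taylor_eq_prod (f : ℂ[X]) (w : ℂ) : (taylor w f).trailingCoeff =
    f.leadingCoeff * (f.roots.map fun y => if y = w then 1 else w - y).prod := by
  have h : taylor w f = C f.leadingCoeff * (f.roots.map fun y => X + C (w - y)).prod := by
    conv_lhs => rw [(IsAlgClosed.splits f).eq_prod_roots]
    have hp : taylor w (f.roots.map fun y => X - C y).prod = _ :=
      map_multiset_prod (taylorAlgHom w) _
    rw [taylor_mul, taylor_C, hp, Multiset.map_map]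
    congr 3
    ext1 y
    simp [add_sub_assoc]
  rw [h, trailingCoeff_mul, trailingCoeff_C', trailingCoeff_multiset_prod, Multiset.map_map]
  congr 3
  ext1 y
  simp only [Function.comp]
  split_ifs with hy
  · simp [hy, trailingCoeff]
  · have : (X + C (w - y)).coeff 0 ≠ 0 := by simpa [sub_eq_zero, eq_comm] using hy
    rw [trailingCoeff_eq_coeff_zero this]
    simp

/-- `∑ log⁺ |y|` over the roots `y` of `f`, counted with multiplicity. -/
noncomputable def sumPosLog (f : ℂ[X]) : ℝ := (f.roots.map fun y => Real.posLog ‖y‖).sum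

theorem sumPosLog_nonneg (f : ℂ[X]) : 0 ≤ sumPosLog f :=
  Multiset.sum_nonneg fun x hx => by
    obtain ⟨y, -, rfl⟩ := Multiset.mem_map.1 hx
    exact Real.posLog_nonneg

/-- `log` of the norm of the trailing coefficient of `f(w + U)`. -/
noncomputable def logTrail (f : ℂ[X]) (w : ℂ) : ℝ := Real.log ‖(taylor w f).trailingCoeff‖

theorem logTrail_eq {f : ℂ[X]} (hf : f ≠ 0) (w : ℂ) : logTrail f w = Real.log ‖f.leadingCoeff‖ +
    (f.roots.map fun y => if y = w then 0 else Real.log ‖y - w‖).sum := by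
  have h0 : ∀ x ∈ f.roots.map fun y => ‖if y = w then 1 else w - y‖, x ≠ 0 := by
    intro x hx
    obtain ⟨y, -, rfl⟩ := Multiset.mem_map.1 hx
    split_ifs with h
    · simp
    · simpa [sub_eq_zero, eq_comm] using h
  have h1 : (f.roots.map fun y => ‖if y = w then 1 else w - y‖).prod ≠ 0 :=
    Multiset.prod_ne_zero fun h => h0 0 h rfl
  rw [logTrail, trailingCoeff_taylor_eq_prod, norm_mul, norm_multiset_prod, Multiset.map_map]
  simp only [Function.comp_def]
  rw [Real.log_mul (by simpa using hf) h1, Real.log_multiset_prod h0, Multiset.map_map]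
  congr 3
  ext1 y
  simp only [Function.comp]
  split_ifs
  · simp
  · rw [norm_sub_rev]

theorem log_norm_sub_le (y w : ℂ) :
    Real.log ‖y - w‖ ≤ Real.log 2 + Real.posLog ‖w‖ + Real.posLog ‖y‖ := by
  have h := Real.posLog_norm_add_le y (-w)
  rw [norm_neg, ← sub_eq_add_neg] at h
  exact (le_max_right 0 (Real.log ‖y - w‖)).trans (by rw [← Real.posLog]; linarith)

theorem sum_log_add_posLog_le {f : ℂ[X]} {n : ℕ} (hn : f.natDegree ≤ n) (w : ℂ) :
    (f.roots.map fun y => Real.log 2 + Real.posLog ‖w‖ + Real.posLog ‖y‖).sum ≤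
      n * Real.log 2 + n * Real.posLog ‖w‖ + sumPosLog f := by
  have hc : (f.roots.card : ℝ) ≤ n := by exact_mod_cast (card_roots' f).trans hn
  have h2 : 0 ≤ Real.log 2 := Real.log_nonneg (by norm_num)
  have hw : 0 ≤ Real.posLog ‖w‖ := Real.posLog_nonneg
  rw [Multiset.sum_map_add, Multiset.map_const', Multiset.sum_replicate, nsmul_eq_mul, sumPosLog]
  nlinarith [mul_le_mul_of_nonneg_right hc (add_nonneg h2 hw)]

theorem le_sum_of_mem_of_nonneg {s : Multiset ℂ} {b : ℂ → ℝ} (hb : ∀ y, 0 ≤ b y) {y : ℂ}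
    (hy : y ∈ s) : b y ≤ (s.map b).sum := by
  classical
  rw [← Multiset.cons_erase hy, Multiset.map_cons, Multiset.sum_cons]
  have : 0 ≤ ((s.erase y).map b).sum := Multiset.sum_nonneg fun x hx => by
    obtain ⟨u, -, rfl⟩ := Multiset.mem_map.1 hx
    exact hb u
  linarith

theorem sum_le_add_sum_of_mem {s : Multiset ℂ} {b c : ℂ → ℝ} (hb : ∀ y, 0 ≤ b y)
    (hcb : ∀ y, c y ≤ b y) {y : ℂ} (hy : y ∈ s) : (s.map c).sum ≤ c y + (s.map b).sum := by
  classical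
  rw [← Multiset.cons_erase hy, Multiset.map_cons, Multiset.sum_cons, Multiset.map_cons,
    Multiset.sum_cons]
  have := Multiset.sum_map_le_sum_map (s := s.erase y) c b fun i _ => hcb i
  linarith [hb y]

theorem log_sep_bound_nonneg (f : ℂ[X]) (n : ℕ) (w : ℂ) :
    0 ≤ n * Real.log 2 + n * Real.posLog ‖w‖ + sumPosLog f := by
  have := sumPosLog_nonneg f
  have : 0 ≤ Real.posLog ‖w‖ := Real.posLog_nonneg
  have : 0 ≤ Real.log 2 := Real.log_nonneg (by norm_num)
  positivity

/-- For the second bound, one copy of a nearest root is kept exactly in the sum of log|y-w| and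
every other term is replaced by its nonnegative upper bound from `log_norm_sub_le`. -/
theorem log_sep_bounds {f : ℂ[X]} (hf : f ≠ 0) {n : ℕ} (hn : f.natDegree ≤ n) (w : ℂ) :
    Real.log (sep w f) ≤ n * Real.log 2 + n * Real.posLog ‖w‖ + sumPosLog f ∧
    logTrail f w ≤ Real.log ‖f.leadingCoeff‖ + Real.log (sep w f) +
      (n * Real.log 2 + n * Real.posLog ‖w‖ + sumPosLog f) := by
  have h2 : 0 ≤ Real.log 2 := Real.log_nonneg (by norm_num)
  have hw : 0 ≤ Real.posLog ‖w‖ := Real.posLog_nonneg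
  have hB := sum_log_add_posLog_le hn w
  have hb : ∀ y : ℂ, 0 ≤ Real.log 2 + Real.posLog ‖w‖ + Real.posLog ‖y‖ := fun y => by
    have : 0 ≤ Real.posLog ‖y‖ := Real.posLog_nonneg
    positivity
  rw [logTrail_eq hf]
  unfold sep
  split_ifs with h
  · obtain ⟨y, hy, hy'⟩ := Finset.exists_mem_eq_inf' h (fun y => ‖y - w‖)
    rw [hy']
    obtain ⟨hyw, hyr⟩ := Finset.mem_erase.1 hy
    have hyr : y ∈ f.roots := Multiset.mem_toFinset.1 hyr
    constructor
    · exact (log_norm_sub_le y w).trans ((le_sum_of_mem_of_nonneg hb hyr).trans hB)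
    · have := sum_le_add_sum_of_mem (c := fun y => if y = w then 0 else Real.log ‖y - w‖) hb
        (fun y => by
          split_ifs
          · exact hb y
          · exact log_norm_sub_le y w) hyr
      simp only [if_neg hyw] at this
      linarith
  · have hz : (f.roots.map fun y => if y = w then 0 else Real.log ‖y - w‖).sum = 0 := by
      refine Multiset.sum_eq_zero fun x hx => ?_
      obtain ⟨y, hy, rfl⟩ := Multiset.mem_map.1 hx
      refine if_pos ?_
      by_contra hne
      exact h ⟨y, Finset.mem_erase.2 ⟨hne, Multiset.mem_toFinset.2 hy⟩⟩
    rw [hz, Real.log_one]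
    have := log_sep_bound_nonneg f n w
    constructor <;> linarith

/-- An upper bound for the sums of `|log sep|` and of `|logTrail|` over the roots of `f`. -/
noncomputable def rootBound (f : ℂ[X]) (n : ℕ) : ℝ :=
  2 * n * max (Real.log ‖f.leadingCoeff‖) 0 + 4 * (n * (n * Real.log 2) + 2 * n * sumPosLog f) -
    (f.roots.map (logTrail f)).sum

/-- The hypothesis carries a signed `- logTrail`, because only the signed sum of `logTrail` can be
bounded below after summing over z. -/
theorem sum_abs_le_rootBound {f : ℂ[X]} {n : ℕ} (hn : f.natDegree ≤ n) {φ : ℂ → ℝ}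
    (hφ : ∀ w, |φ w| ≤ 2 * max (Real.log ‖f.leadingCoeff‖) 0 +
      4 * (n * Real.log 2 + n * Real.posLog ‖w‖ + sumPosLog f) - logTrail f w) :
    (f.roots.map fun w => |φ w|).sum ≤ rootBound f n := by
  have hc : (f.roots.card : ℝ) ≤ n := by exact_mod_cast (card_roots' f).trans hn
  have h2 : 0 ≤ Real.log 2 := Real.log_nonneg (by norm_num)
  have hL := sumPosLog_nonneg f
  refine (Multiset.sum_map_le_sum_map _ _ fun w _ => hφ w).trans ?_
  have e : (f.roots.map fun w => 2 * max (Real.log ‖f.leadingCoeff‖) 0 +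
      4 * (n * Real.log 2 + n * Real.posLog ‖w‖ + sumPosLog f) - logTrail f w).sum =
      f.roots.card * (2 * max (Real.log ‖f.leadingCoeff‖) 0 + 4 * (n * Real.log 2) +
        4 * sumPosLog f) + 4 * n * sumPosLog f - (f.roots.map (logTrail f)).sum := by
    have h4 : 4 * n * sumPosLog f = (f.roots.map fun w => 4 * n * Real.posLog ‖w‖).sum := by
      rw [Multiset.sum_map_mul_left, sumPosLog]
    rw [Multiset.sum_map_sub, h4, ← nsmul_eq_mul f.roots.card, ← Multiset.sum_replicate,
      ← Multiset.map_const', ← Multiset.sum_map_add]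
    congr 3
    ext1 w
    ring
  rw [e, rootBound]
  have hm : 0 ≤ max (Real.log ‖f.leadingCoeff‖) 0 := le_max_right _ _
  have := mul_le_mul_of_nonneg_right hc (show 0 ≤ 2 * max (Real.log ‖f.leadingCoeff‖) 0 +
    4 * (n * Real.log 2) + 4 * sumPosLog f by positivity)
  linarith

theorem sum_abs_logb_div (f : ℂ[X]) (φ : ℂ → ℝ) :
    ∑ w ∈ rootsC f, (f.rootMultiplicity w : ℝ) * |Real.logb 2 (φ w)| =
      (f.roots.map fun w => |Real.log (φ w)|).sum / Real.log 2 := by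
  rw [sum_rootsC_rootMultiplicity_mul, ← Multiset.sum_map_div]
  congr 2
  ext1 w
  rw [Real.logb, abs_div, abs_of_pos (Real.log_pos (by norm_num : (1 : ℝ) < 2))]

theorem max_one_le_of_le {f : ℂ[X]} {n : ℕ} {φ : ℂ → ℝ}
    (h : (f.roots.map fun w => |Real.log (φ w)|).sum ≤ rootBound f n) :
    max 1 (∑ w ∈ rootsC f, (f.rootMultiplicity w : ℝ) * |Real.logb 2 (φ w)|) ≤
      1 + rootBound f n / Real.log 2 := by
  have h2 : 0 < Real.log 2 := Real.log_pos (by norm_num)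
  have h0 : 0 ≤ (f.roots.map fun w => |Real.log (φ w)|).sum :=
    Multiset.sum_nonneg fun x hx => by
      obtain ⟨y, -, rfl⟩ := Multiset.mem_map.1 hx
      exact abs_nonneg _
  rw [sum_abs_logb_div]
  have h3 := div_le_div_of_nonneg_right h h2.le
  have h4 := div_nonneg h0 h2.le
  exact max_le (by linarith) (by linarith)

theorem logGDisc_le {f : ℂ[X]} (hf : f ≠ 0) {n : ℕ} (hn : f.natDegree ≤ n) :
    logGDisc f ≤ 1 + rootBound f n / Real.log 2 := by
  refine max_one_le_of_le (sum_abs_le_rootBound hn fun w => ?_)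
  rw [← trailingCoeff_taylor, ← logTrail]
  obtain ⟨h1, h2⟩ := log_sep_bounds hf hn w
  have h3 := le_max_left (Real.log ‖f.leadingCoeff‖) 0
  have h4 := le_max_right (Real.log ‖f.leadingCoeff‖) 0
  have h5 := log_sep_bound_nonneg f n w
  -- With a = log|lc f| and B the bound of `log_sep_bounds`, `logTrail` is at most a + 2B; doubling
  -- this gives the constants 2 and 4.
  exact abs_le.2 ⟨by linarith, by linarith⟩

theorem logsep_le {f : ℂ[X]} (hf : f ≠ 0) {n : ℕ} (hn : f.natDegree ≤ n) :
    logsep f ≤ 1 + rootBound f n / Real.log 2 := by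
  refine max_one_le_of_le (sum_abs_le_rootBound hn fun w => ?_)
  obtain ⟨h1, h2⟩ := log_sep_bounds hf hn w
  have h3 := le_max_left (Real.log ‖f.leadingCoeff‖) 0
  have h4 := le_max_right (Real.log ‖f.leadingCoeff‖) 0
  have h5 := log_sep_bound_nonneg f n w
  exact abs_le.2 ⟨by linarith, by linarith⟩

end Roots

/-! ### Mahler measure bounds. -/

section Mahler

theorem norm_intCast_le_two_pow {a : ℤ} {τ : ℕ} (h : |a| ≤ 2 ^ τ) : ‖(a : ℂ)‖ ≤ 2 ^ τ := by
  rw [Complex.norm_intCast]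
  exact_mod_cast h

theorem norm_eval₂_le {c : ℤ[X]} {n τ : ℕ} (hd : c.natDegree ≤ n) (hc : ∀ i, |c.coeff i| ≤ 2 ^ τ)
    (z : ℂ) : ‖eval₂ (Int.castRingHom ℂ) z c‖ ≤ (n + 1) * (2 ^ τ * max 1 ‖z‖ ^ n) := by
  rw [eval₂_eq_sum_range' (Int.castRingHom ℂ) (n := n + 1) (by omega)]
  refine (norm_sum_le _ _).trans ?_
  have h := Finset.sum_le_card_nsmul (Finset.range (n + 1))
    (fun i => ‖(Int.castRingHom ℂ) (c.coeff i) * z ^ i‖) (2 ^ τ * max 1 ‖z‖ ^ n) fun i hi => by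
      rw [norm_mul, norm_pow]
      refine mul_le_mul (norm_intCast_le_two_pow (hc i)) ?_ (by positivity) (by positivity)
      calc ‖z‖ ^ i ≤ max 1 ‖z‖ ^ i := pow_le_pow_left₀ (norm_nonneg z) (le_max_right _ _) i
        _ ≤ max 1 ‖z‖ ^ n :=
          pow_le_pow_right₀ (le_max_left _ _) (Nat.lt_succ_iff.1 (Finset.mem_range.1 hi))
  refine h.trans (le_of_eq ?_)
  rw [Finset.card_range, nsmul_eq_mul]
  push_cast
  ring

/-- The left side is the logarithmic Mahler measure, and the Mahler measure is at most the sum of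
the norms of the coefficients. -/
theorem log_leadingCoeff_add_sumPosLog_le {f : ℂ[X]} (hf : f ≠ 0) {n : ℕ} (hn : f.natDegree ≤ n)
    {K : ℝ} (hK : ∀ j, ‖f.coeff j‖ ≤ K) :
    Real.log ‖f.leadingCoeff‖ + sumPosLog f ≤ Real.log ((n + 1) * K) := by
  rw [sumPosLog, ← logMahlerMeasure_eq_log_leadingCoeff_add_sum_log_roots,
    logMahlerMeasure_eq_log_MahlerMeasure]
  refine Real.log_le_log (mahlerMeasure_pos_of_ne_zero hf) ?_
  refine (mahlerMeasure_le_sum_norm_coeff f).trans ?_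
  rw [sum_over_range' _ _ (n + 1) (by omega)]
  · refine (Finset.sum_le_card_nsmul _ _ K fun j _ => hK j).trans (le_of_eq ?_)
    rw [Finset.card_range, nsmul_eq_mul]
    push_cast
    ring
  · simp

theorem log_add_one_le_mul_log_two (n : ℕ) : Real.log ((n : ℝ) + 1) ≤ n * Real.log 2 := by
  rw [← Real.log_pow]
  refine Real.log_le_log (by positivity) ?_
  exact_mod_cast Nat.lt_two_pow_self (n := n)

/-- The bound for the Mahler measure of `F(z, -)`. -/
theorem fiber_log_leadingCoeff_add_sumPosLog_le {F : ℤ[X][X]} {n τ : ℕ} (hF : HasMagnitude₂ F n τ)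
    {z : ℂ} (hz : fiber F z ≠ 0) :
    Real.log ‖(fiber F z).leadingCoeff‖ + sumPosLog (fiber F z) ≤
      2 * (n * Real.log 2) + τ * Real.log 2 + n * Real.posLog ‖z‖ := by
  refine (log_leadingCoeff_add_sumPosLog_le hz (hF.natDegree_fiber_le z) fun j => by
    rw [coeff_fiber]
    exact norm_eval₂_le (hF.natDegree_coeff_le j) (hF.2 · j) z).trans ?_
  have hm : 0 < max 1 ‖z‖ := lt_max_of_lt_left one_pos
  have hn : (n : ℝ) + 1 ≠ 0 := by positivity
  rw [Real.log_mul hn (by positivity), Real.log_mul hn (by positivity),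
    Real.log_mul (by positivity) (by positivity), Real.log_pow, Real.log_pow,
    ← Real.posLog_eq_log_max_one (norm_nonneg z)]
  linarith [log_add_one_le_mul_log_two n]

theorem natDegree_toC (R : ℤ[X]) : (toC R).natDegree = R.natDegree :=
  natDegree_map_eq_of_injective Int.cast_injective R

theorem leadingCoeff_toC (R : ℤ[X]) : (toC R).leadingCoeff = (R.leadingCoeff : ℂ) :=
  leadingCoeff_map_of_injective (f := Int.castRingHom ℂ) Int.cast_injective R

theorem toC_ne_zero {R : ℤ[X]} (hR : R ≠ 0) : toC R ≠ 0 :=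
  (Polynomial.map_ne_zero_iff Int.cast_injective).2 hR

theorem log_leadingCoeff_nonneg {R : ℤ[X]} (hR : R ≠ 0) :
    0 ≤ Real.log ‖(R.leadingCoeff : ℂ)‖ := by
  refine Real.log_nonneg ?_
  rw [Complex.norm_intCast]
  exact_mod_cast Int.one_le_abs (leadingCoeff_ne_zero.2 hR)

theorem log_leadingCoeff_le {R : ℤ[X]} (hR : R ≠ 0) {N Λ : ℕ} (h : HasMagnitude R N Λ) :
    Real.log ‖(R.leadingCoeff : ℂ)‖ ≤ Λ * Real.log 2 := by
  rw [← Real.log_pow]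
  exact Real.log_le_log (norm_pos_iff.2 (by simpa using hR)) (norm_intCast_le_two_pow (h.2 _))

theorem sumPosLog_toC_le {R : ℤ[X]} (hR : R ≠ 0) {N Λ : ℕ} (h : HasMagnitude R N Λ) :
    sumPosLog (toC R) ≤ N * Real.log 2 + Λ * Real.log 2 := by
  have h1 := log_leadingCoeff_add_sumPosLog_le (toC_ne_zero hR) ((natDegree_toC R).trans_le h.1)
    (K := 2 ^ Λ) fun j => by
      rw [toC, coeff_map]
      exact norm_intCast_le_two_pow (h.2 j)
  rw [leadingCoeff_toC, Real.log_mul (by positivity) (by positivity), Real.log_pow] at h1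
  linarith [log_add_one_le_mul_log_two N, log_leadingCoeff_nonneg hR]

end Mahler

/-! ### Summation over the roots of R. -/

section Amortized

theorem fiber_ne_zero_of_finite {R : ℤ[X]} {F : ℤ[X][X]} (h : (zeroSet R F).Finite) {z : ℂ}
    (hz : z ∈ (toC R).roots) : fiber F z ≠ 0 := fun h0 => by
  refine (Set.infinite_range_of_injective (Prod.mk_right_injective z) :
    (Set.range (Prod.mk z : ℂ → ℂ × ℂ)).Infinite) (h.subset ?_)
  rintro _ ⟨w, rfl⟩
  exact ⟨isRoot_of_mem_roots hz, by simp [h0]⟩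

theorem log_trailingCoeff_discForm {F : ℤ[X][X]} {n τ : ℕ} (hF : HasMagnitude₂ F n τ) {z : ℂ}
    (hz : fiber F z ≠ 0) : Real.log ‖(specialize z (discForm F n)).trailingCoeff‖ =
      n * Real.log ‖(fiber F z).leadingCoeff‖ +
        ((fiber F z).roots.map (logTrail (fiber F z))).sum := by
  have h0 : ∀ x ∈ (fiber F z).roots.map fun w => ‖(taylor w (fiber F z)).trailingCoeff‖,
      x ≠ 0 := by
    intro x hx
    obtain ⟨w, -, rfl⟩ := Multiset.mem_map.1 hx
    simpa using hz
  rw [norm_trailingCoeff_specialize_discForm hF hz, Real.log_mul (by simp [hz])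
    (Multiset.prod_ne_zero fun h => h0 0 h rfl), Real.log_pow, Real.log_multiset_prod h0,
    Multiset.map_map]
  rfl

/-- Write a for log|lc|, S for `sumPosLog` and E for the Mahler bound, so a + S ≤ E. Then
2n·max(a,0) + 8nS ≤ 10nE - 8na, and trading the sum of `logTrail` for `discForm` returns one na,
leaving -7na. -/
theorem rootBound_fiber_le {F : ℤ[X][X]} {n τ : ℕ} (hF : HasMagnitude₂ F n τ) {z : ℂ}
    (hz : fiber F z ≠ 0) : rootBound (fiber F z) n ≤
      10 * n * (2 * (n * Real.log 2) + τ * Real.log 2 + n * Real.posLog ‖z‖) +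
      4 * (n * (n * Real.log 2)) -
      7 * n * Real.log ‖(specialize z (leadForm F n)).trailingCoeff‖ -
      Real.log ‖(specialize z (discForm F n)).trailingCoeff‖ := by
  have h := fiber_log_leadingCoeff_add_sumPosLog_le hF hz
  have hL := sumPosLog_nonneg (fiber F z)
  have h2 : 0 ≤ Real.log 2 := Real.log_nonneg (by norm_num)
  have hp : 0 ≤ Real.posLog ‖z‖ := Real.posLog_nonneg
  rw [log_trailingCoeff_discForm hF hz, trailingCoeff_specialize_leadForm hF hz, rootBound]
  set a := Real.log ‖(fiber F z).leadingCoeff‖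
  set E := 2 * (n * Real.log 2) + τ * Real.log 2 + n * Real.posLog ‖z‖ with hE
  have hm : max a 0 ≤ E := max_le (by linarith) (by positivity)
  have hn : (0 : ℝ) ≤ n := n.cast_nonneg
  have h3 := mul_le_mul_of_nonneg_left hm hn
  have h4 := mul_le_mul_of_nonneg_left h hn
  linarith

theorem sum_rootBound_le {R : ℤ[X]} (hR : R ≠ 0) {F : ℤ[X][X]} {N Λ n τ : ℕ}
    (hN : HasMagnitude R N Λ) (hF : HasMagnitude₂ F n τ) (hfin : (zeroSet R F).Finite) :
    ((toC R).roots.map fun z => rootBound (fiber F z) n).sum ≤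
      40 * ((n : ℝ) * (N * τ + n * Λ + N * n)) * Real.log 2 := by
  have hz : ∀ z ∈ (toC R).roots, fiber F z ≠ 0 := fun z => fiber_ne_zero_of_finite hfin
  have h1 := zero_le_log_leadingCoeff_add_sum_log_trailingCoeff hR (natDegree_leadForm_le hF)
    fun z h => specialize_leadForm_ne_zero hF (hz z h)
  have h2 := zero_le_log_leadingCoeff_add_sum_log_trailingCoeff hR (natDegree_discForm_le hF)
    fun z h => specialize_discForm_ne_zero hF (hz z h)
  have hc : ((toC R).roots.card : ℝ) ≤ N := by
    exact_mod_cast (card_roots' _).trans ((natDegree_toC R).trans_le hN.1)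
  have hlog : 0 ≤ Real.log 2 := Real.log_nonneg (by norm_num)
  have hn : (0 : ℝ) ≤ n := n.cast_nonneg
  refine (Multiset.sum_map_le_sum_map _ _ fun z h => rootBound_fiber_le hF (hz z h)).trans ?_
  rw [Multiset.sum_map_sub, Multiset.sum_map_sub, Multiset.sum_map_mul_left]
  have e : ((toC R).roots.map fun z =>
      10 * n * (2 * (n * Real.log 2) + τ * Real.log 2 + n * Real.posLog ‖z‖) +
        4 * (n * (n * Real.log 2))).sum =
      (toC R).roots.card * (24 * n * n * Real.log 2 + 10 * n * τ * Real.log 2) +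
        10 * n * n * sumPosLog (toC R) := by
    rw [sumPosLog, ← Multiset.sum_map_mul_left, ← nsmul_eq_mul (toC R).roots.card,
      ← Multiset.sum_replicate, ← Multiset.map_const', ← Multiset.sum_map_add]
    congr 2
    ext1 z
    ring
  rw [e]
  have h3 := mul_le_mul_of_nonneg_right hc
    (show 0 ≤ 24 * n * n * Real.log 2 + 10 * n * τ * Real.log 2 by positivity)
  have h4 := mul_le_mul_of_nonneg_left (sumPosLog_toC_le hR hN)
    (show (0 : ℝ) ≤ 10 * n * n by positivity)
  -- The 9n² collects 7n·n from `leadForm` and 2n² from `discForm`, the exponents of lc(R).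
  have h5 := mul_le_mul_of_nonneg_left (log_leadingCoeff_le hR hN)
    (show (0 : ℝ) ≤ 9 * (n * n) by positivity)
  have h6 := mul_nonneg (show (0 : ℝ) ≤ 7 * n by positivity) h1
  push_cast at h2
  have p1 : 0 ≤ (n : ℝ) * (N * τ) * Real.log 2 := by positivity
  have p2 : 0 ≤ (n : ℝ) * (n * Λ) * Real.log 2 := by positivity
  have p3 : 0 ≤ (n : ℝ) * (N * n) * Real.log 2 := by positivity
  linarith

theorem amortized_bound {R : ℤ[X]} (hR : R ≠ 0) {F : ℤ[X][X]} {N Λ n τ : ℕ} (hn : 1 ≤ n)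
    (hN : HasMagnitude R N Λ) (hF : HasMagnitude₂ F n τ) (hfin : (zeroSet R F).Finite)
    {φ : ℂ[X] → ℝ} (hφ : ∀ f : ℂ[X], f ≠ 0 → f.natDegree ≤ n →
      φ f ≤ 1 + rootBound f n / Real.log 2) :
    ∑ z ∈ rootsC (toC R), ((toC R).rootMultiplicity z : ℝ) * φ (fiber F z) ≤
      41 * ((n : ℝ) * (N * τ + n * Λ + N * n)) := by
  have hlog : 0 < Real.log 2 := Real.log_pos (by norm_num)
  have hc : ((toC R).roots.card : ℝ) ≤ N := by
    exact_mod_cast (card_roots' _).trans ((natDegree_toC R).trans_le hN.1)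
  rw [sum_rootsC_rootMultiplicity_mul]
  refine (Multiset.sum_map_le_sum_map _ _ fun z h =>
    hφ (fiber F z) (fiber_ne_zero_of_finite hfin h) (hF.natDegree_fiber_le z)).trans ?_
  rw [Multiset.sum_map_add, Multiset.sum_map_div, Multiset.map_const', Multiset.sum_replicate,
    nsmul_eq_mul, mul_one]
  have h1 := (div_le_iff₀ hlog).2 (sum_rootBound_le hR hN hF hfin)
  -- The summand 1 in each fiber contributes at most N ≤ N·n², turning 40 into 41.
  have hn' : (1 : ℝ) ≤ n * n := by exact_mod_cast Nat.one_le_iff_ne_zero.2 (by positivity)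
  have h2 := mul_le_mul_of_nonneg_left hn' (N.cast_nonneg : (0 : ℝ) ≤ N)
  have p1 : 0 ≤ (n : ℝ) * (N * τ) := by positivity
  have p2 : 0 ≤ (n : ℝ) * (n * Λ) := by positivity
  linarith

end Amortized

end AmortizedBounds

theorem mainTheorem6 :
    (∃ (C : ℝ) (k : ℕ), ∀ (N Λ n τ : ℕ) (R : ℤ[X]) (F : ℤ[X][X]),
      1 ≤ n → R ≠ 0 → AmortizedBounds.HasMagnitude R N Λ → AmortizedBounds.HasMagnitude₂ F n τ →
      (AmortizedBounds.zeroSet R F).Finite →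
      ∑ z ∈ AmortizedBounds.rootsC (AmortizedBounds.toC R),
          ((AmortizedBounds.toC R).rootMultiplicity z : ℝ) *
            AmortizedBounds.logGDisc (AmortizedBounds.fiber F z) ≤
        C * ((n : ℝ) * (N * τ + n * Λ + N * n)) *
          Real.logb 2 (2 + (n : ℝ) * (N * τ + n * Λ + N * n)) ^ k) ∧
    (∃ (C : ℝ) (k : ℕ), ∀ (N Λ n τ : ℕ) (R : ℤ[X]) (F : ℤ[X][X]),
      1 ≤ n → R ≠ 0 → AmortizedBounds.HasMagnitude R N Λ → AmortizedBounds.HasMagnitude₂ F n τ →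
      (AmortizedBounds.zeroSet R F).Finite →
      ∑ z ∈ AmortizedBounds.rootsC (AmortizedBounds.toC R),
          ((AmortizedBounds.toC R).rootMultiplicity z : ℝ) *
            AmortizedBounds.logsep (AmortizedBounds.fiber F z) ≤
        C * ((n : ℝ) * (N * τ + n * Λ + N * n)) *
          Real.logb 2 (2 + (n : ℝ) * (N * τ + n * Λ + N * n)) ^ k) := by
  -- The exponent 0 means that no logarithmic factor is needed.
  refine ⟨⟨41, 0, fun N Λ n τ R F hn hR hN hF hfin => ?_⟩,
    ⟨41, 0, fun N Λ n τ R F hn hR hN hF hfin => ?_⟩⟩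
  · rw [pow_zero, mul_one]
    exact AmortizedBounds.amortized_bound hR hn hN hF hfin
      fun _ hf hd => AmortizedBounds.logGDisc_le hf hd
  · rw [pow_zero, mul_one]
    exact AmortizedBounds.amortized_bound hR hn hN hF hfin
      fun _ hf hd => AmortizedBounds.logsep_le hf hd
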